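/- Let $\mathcal{G}=(\mathcal{N},\mathcal{E})$, $\mathcal{N}=\{1,\dots,N_0\}$, be an undirected graph without loops, and let $\mathcal{C}_1,\dots,\mathcal{C}_q$ be cliques of $\mathcal{G}$ such that every node lies in some $\mathcal{C}_k$ and two different nodes $i,j$ lie in a common $\mathcal{C}_k$ if and only if $(i,j)\in\mathcal{E}$. Let $n=\sum_i n_i$ and consider $$x(k+1)=Ax(k)+Bu(k)+B_vv(k),\qquad y(k)=Cx(k)+Du(k)+D_wv(k),$$ with real matrices, where $x=(x_i)_i$ and $u=(u_i)_i$ have blocks $x_i,u_i\in\mathbb{R}^{n_i}$, and $v\in\mathbb{R}^{m_v}$, $y\in\mathbb{R}^{l}$. Let $\gamma>0$. Let $$\mathcal{S}=\{K\in\mathbb{R}^{n\times n}:K_{ij}=O\text{ whenever }i\ne j\text{ and }(i,j)\notin\mathcal{E}\},$$ where $K_{ij}\in\mathbb{R}^{n_i\times n_j}$ are the blocks of $K$. Let $\mathcal{K}^{\infty,\gamma}_{\rm all}$ be the set of all $K\in\mathcal{S}$ such that $A+BK$ is Schur (all eigenvalues in the open unit disc) and $\|T\|_\infty:=\sup_{|z|=1}\sigma_{\max}(T(z))<\gamma$,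 where $T(z)=(C+DK)(zI-(A+BK))^{-1}B_v+D_w$. Let $\mathcal{K}^{\infty,\gamma}_{\rm diag}$ be the set of all $K=ZQ^{-1}$ with $Z\in\mathcal{S}$ and $Q={\rm blkdiag}(Q_1,\dots,Q_{N_0})\succ O$, $Q_i\in\mathbb{R}^{n_i\times n_i}$, such that $$\begin{bmatrix}-Q&\ast&\ast&\ast\\(AQ+BZ)^\top&-Q&\ast&\ast\\B_v^\top&O&-\gamma I&\ast\\O&CQ+DZ&D_w&-\gamma I\end{bmatrix}\prec O .$$ For $j\in\mathcal{N}$ let $E_j\in\mathbb{R}^{n_j\times n}$ be the matrix with $E_jx=x_j$, let $E_{\mathcal{C}_k}$ be the matrices $E_j$, $j\in\mathcal{C}_k$, stacked vertically, and let $E$ be the matrices $E_{\mathcal{C}_1},\dots,E_{\mathcal{C}_q}$ stacked vertically. Put $N=I-E(E^\top E)^{-1}E^\top$, $M={\rm blkdiag}(N,N)$, $$\tilde A=EA(E^\top E)^{-1}E^\top,\quad \tilde B=EB(E^\top E)^{-1}E^\top,\quad \tilde C=C(E^\top E)^{-1}E^\top,\quad \tilde D=D(E^\top E)^{-1}E^\top,\quad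 \tilde B_v=EB_v,$$ $$\Gamma_\gamma(\tilde Q,\tilde Z)=\begin{bmatrix}-\tilde Q&\ast&\ast&\ast\\(\tilde A\tilde Q+\tilde B\tilde Z)^\top&-\tilde Q&\ast&\ast\\\tilde B_v^\top&O&-\gamma I&\ast\\O&\tilde C\tilde Q+\tilde D\tilde Z&D_w&-\gamma I\end{bmatrix}.$$ Let $\mathcal{K}^{\infty,\gamma}_{\mathcal{S}}$ be the set of all $K=(E^\top E)^{-1}E^\top(\tilde Z\tilde Q^{-1})E$ for which $\tilde Z={\rm blkdiag}(\tilde Z_1,\dots,\tilde Z_q)$ and $\tilde Q={\rm blkdiag}(\tilde Q_1,\dots,\tilde Q_q)\succ O$ are block diagonal, with the $k$-th block of size $\sum_{j\in\mathcal{C}_k}n_j$, and there are $\rho\in\mathbb{R}$ and $\eta>0$ with $$-\Gamma_\gamma(\tilde Q,\tilde Z)+{\rm blkdiag}(\rho M,O)\succ O,\qquad N\tilde Q+\tilde QN\succeq\eta N .$$ Here $O$ is the zero matrix of size $m_v+l$. Then $\mathcal{K}^{\infty,\gamma}_{\rm diag}\subseteq\mathcal{K}^{\infty,\gamma}_{\mathcal{S}}\subseteq\mathcal{K}^{\infty,\gamma}_{\rm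 all}$. -/

import Mathlib

open scoped Matrix

noncomputable section

namespace CliqueHinf

/-! ### Indices, the graph-induced sparsity pattern and the clique selection matrix -/

section Indices

variable {V : Type*} [Fintype V] [DecidableEq V]

/-- Coordinates of the stacked vector `(x_i)_{i ∈ V}` with `x_i ∈ ℝ^{n_i}`. They index both the
state and the input, whose blocks have the same sizes. -/
abbrev StateIdx (n : V → ℕ) : Type _ := Σ i : V, Fin (n i)

/-- Coordinates of the subvector `(x_j)_{j ∈ c}`; their number is `n_c = ∑_{j ∈ c} n_j`. -/
abbrev CliqueIdx (n : V → ℕ) (c : Finset V) : Type _ := Σ j : {j : V // j ∈ c}, Fin (n j.1)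

/-- Coordinates of the dilated vector, which stacks the subvectors of all cliques `C k`. -/
abbrev DilIdx {κ : Type*} (n : V → ℕ) (C : κ → Finset V) : Type _ :=
  Σ k : κ, CliqueIdx n (C k)

/-- The set `𝒮`: the block `K_{ij}` vanishes whenever `i ≠ j` and `i`, `j` are not adjacent. -/
def sparse (G : SimpleGraph V) (n : V → ℕ) : Set (Matrix (StateIdx n) (StateIdx n) ℝ) :=
  {K | ∀ i j : V, i ≠ j → ¬ G.Adj i j → ∀ (a : Fin (n i)) (b : Fin (n j)), K ⟨i, a⟩ ⟨j, b⟩ = 0}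

/-- `C` is a finite family of cliques of `G` such that every node lies in a member of the family,
and two different nodes lie in a common member if and only if they are adjacent. -/
structure IsCliqueCover {κ : Type*} (G : SimpleGraph V) (C : κ → Finset V) : Prop where
  isClique : ∀ k, G.IsClique (C k : Set V)
  cover : ∀ i : V, ∃ k, i ∈ C k
  common_iff_adj : ∀ i j : V, i ≠ j → ((∃ k, i ∈ C k ∧ j ∈ C k) ↔ G.Adj i j)

/-- `E_j = [0, …, I_{n_j}, …, 0]`. -/
def nodeSel (n : V → ℕ) (j : V) : Matrix (Fin (n j)) (StateIdx n) ℝ :=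
  Matrix.of fun a s => if (⟨j, a⟩ : StateIdx n) = s then 1 else 0

/-- `E_c`: the matrices `E_j`, `j ∈ c`, stacked vertically. -/
def cliqueSel (n : V → ℕ) (c : Finset V) : Matrix (CliqueIdx n c) (StateIdx n) ℝ :=
  Matrix.of fun p s => nodeSel n p.1.1 p.2 s

/-- `E`: the matrices `E_{C k}` stacked vertically. -/
def dilE {κ : Type*} (n : V → ℕ) (C : κ → Finset V) : Matrix (DilIdx n C) (StateIdx n) ℝ :=
  Matrix.of fun p s => cliqueSel n (C p.1) p.2 s

/-- `(Eᵀ E)⁻¹ Eᵀ`. -/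
def dilL {κ : Type*} [Fintype κ] (n : V → ℕ) (C : κ → Finset V) :
    Matrix (StateIdx n) (DilIdx n C) ℝ :=
  ((dilE n C)ᵀ * dilE n C)⁻¹ * (dilE n C)ᵀ

/-- `N = I - E (Eᵀ E)⁻¹ Eᵀ`. -/
def dilN {κ : Type*} [Fintype κ] [DecidableEq κ] (n : V → ℕ) (C : κ → Finset V) :
    Matrix (DilIdx n C) (DilIdx n C) ℝ :=
  1 - dilE n C * dilL n C

/-- `M = blkdiag(N, N)`. -/
def dilM {κ : Type*} [Fintype κ] [DecidableEq κ] (n : V → ℕ) (C : κ → Finset V) :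
    Matrix (DilIdx n C ⊕ DilIdx n C) (DilIdx n C ⊕ DilIdx n C) ℝ :=
  Matrix.fromBlocks (dilN n C) 0 0 (dilN n C)

end Indices

/-! ### The plant and the `H∞` norm of the closed loop -/

section Plant

/-- Matrices of the system `x⁺ = A x + B u + B_v v`, `y = C x + D u + D_w v`, with state and
input indexed by `σ`, `v ∈ ℝ^{m_v}` and `y ∈ ℝ^l`. -/
structure Plant (σ : Type*) (mv l : ℕ) where
  /-- state matrix -/
  A : Matrix σ σ ℝ
  /-- input matrix -/
  B : Matrix σ σ ℝ
  /-- disturbance matrix -/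
  Bv : Matrix σ (Fin mv) ℝ
  /-- output matrix -/
  C : Matrix (Fin l) σ ℝ
  /-- feedthrough matrix of the input -/
  D : Matrix (Fin l) σ ℝ
  /-- feedthrough matrix of the disturbance -/
  Dw : Matrix (Fin l) (Fin mv) ℝ

/-- A real matrix regarded as a complex one. -/
def toC {m p : Type*} (X : Matrix m p ℝ) : Matrix m p ℂ := X.map (fun x : ℝ => (x : ℂ))

/-- All complex eigenvalues lie in the open unit disc. -/
def IsSchur {σ : Type*} [Fintype σ] [DecidableEq σ] (X : Matrix σ σ ℝ) : Prop :=
  ∀ z ∈ spectrum ℂ (toC X), ‖z‖ < 1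

open scoped Matrix.Norms.L2Operator in
/-- `H∞` norm `sup_{|z| = 1} σ_max(T(z))`, with values in `[0, ∞]`, of a discrete-time transfer
matrix without poles in `|z| ≥ 1`; the largest singular value is the `ℓ²` operator norm. -/
def hinfNorm {mv l : ℕ} (T : ℂ → Matrix (Fin l) (Fin mv) ℂ) : ENNReal :=
  ⨆ z : ℂ, ⨆ _ : ‖z‖ = 1, ENNReal.ofReal ‖T z‖

variable {σ : Type*} [Fintype σ] [DecidableEq σ] {mv l : ℕ}

/-- `T(z) = (C + D K) (z I - (A + B K))⁻¹ B_v + D_w`: the transfer matrix from `v` to `y` of the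
closed loop `u = K x`. -/
def transfer (p : Plant σ mv l) (K : Matrix σ σ ℝ) (z : ℂ) : Matrix (Fin l) (Fin mv) ℂ :=
  toC (p.C + p.D * K) * (z • (1 : Matrix σ σ ℂ) - toC (p.A + p.B * K))⁻¹ * toC p.Bv + toC p.Dw

/-- The symmetric block matrix, for `R = A Q + B Z` and `Y = C Q + D Z`,
```
[ -Q     R    B_v    0   ]
[  Rᵀ   -Q     0     Yᵀ  ]
[ B_vᵀ   0    -γ I   D_wᵀ]
[  0     Y    D_w   -γ I ]
```
-/
def brl (γ : ℝ) (p : Plant σ mv l) (Q Z : Matrix σ σ ℝ) :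
    Matrix ((σ ⊕ σ) ⊕ (Fin mv ⊕ Fin l)) ((σ ⊕ σ) ⊕ (Fin mv ⊕ Fin l)) ℝ :=
  Matrix.fromBlocks
    (Matrix.fromBlocks
      (-Q) (p.A * Q + p.B * Z)
      (p.A * Q + p.B * Z)ᵀ (-Q))
    (Matrix.fromBlocks
      p.Bv 0
      0 (p.C * Q + p.D * Z)ᵀ)
    (Matrix.fromBlocks
      p.Bvᵀ 0
      0 (p.C * Q + p.D * Z))
    (Matrix.fromBlocks
      (-(γ • (1 : Matrix (Fin mv) (Fin mv) ℝ))) p.Dwᵀ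
      p.Dw (-(γ • (1 : Matrix (Fin l) (Fin l) ℝ))))

end Plant

/-! ### The three sets of gains -/

section Gains

variable {V : Type*} [Fintype V] [DecidableEq V]

/-- The gains in `𝒮` with `A + B K` Schur and `‖T‖_∞ < γ`. -/
def Kall (G : SimpleGraph V) (n : V → ℕ) {mv l : ℕ} (p : Plant (StateIdx n) mv l) (γ : ℝ) :
    Set (Matrix (StateIdx n) (StateIdx n) ℝ) :=
  {K | K ∈ sparse G n ∧ IsSchur (p.A + p.B * K) ∧
    hinfNorm (transfer p K) < ENNReal.ofReal γ}

/-- The gains `Z Q⁻¹` with `Z ∈ 𝒮`, `Q = blkdiag(Q_1, …, Q_N) ≻ 0` and `brl γ p Q Z ≺ 0`. -/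
def Kdiag (G : SimpleGraph V) (n : V → ℕ) {mv l : ℕ} (p : Plant (StateIdx n) mv l) (γ : ℝ) :
    Set (Matrix (StateIdx n) (StateIdx n) ℝ) :=
  {K | ∃ (Z : Matrix (StateIdx n) (StateIdx n) ℝ)
      (Qb : (i : V) → Matrix (Fin (n i)) (Fin (n i)) ℝ),
    Z ∈ sparse G n ∧
    (Matrix.blockDiagonal' Qb).PosDef ∧
    (-(brl γ p (Matrix.blockDiagonal' Qb) Z)).PosDef ∧
    K = Z * (Matrix.blockDiagonal' Qb)⁻¹}

variable {κ : Type*} [Fintype κ] [DecidableEq κ]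

/-- The dilated plant `Ã = E A (EᵀE)⁻¹Eᵀ`, `B̃ = E B (EᵀE)⁻¹Eᵀ`, `B̃_v = E B_v`,
`C̃ = C (EᵀE)⁻¹Eᵀ`, `D̃ = D (EᵀE)⁻¹Eᵀ`, with `D_w` unchanged. -/
def dilPlant (n : V → ℕ) (C : κ → Finset V) {mv l : ℕ} (p : Plant (StateIdx n) mv l) :
    Plant (DilIdx n C) mv l where
  A := dilE n C * p.A * dilL n C
  B := dilE n C * p.B * dilL n C
  Bv := dilE n C * p.Bv
  C := p.C * dilL n C
  D := p.D * dilL n C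
  Dw := p.Dw

/-- The block matrix `Γ_γ(Q̃, Z̃)` built from the dilated plant. -/
def Gam (n : V → ℕ) (C : κ → Finset V) {mv l : ℕ} (p : Plant (StateIdx n) mv l) (γ : ℝ)
    (Q Z : Matrix (DilIdx n C) (DilIdx n C) ℝ) :
    Matrix ((DilIdx n C ⊕ DilIdx n C) ⊕ (Fin mv ⊕ Fin l))
      ((DilIdx n C ⊕ DilIdx n C) ⊕ (Fin mv ⊕ Fin l)) ℝ :=
  brl γ (dilPlant n C p) Q Z

/-- The gains `(EᵀE)⁻¹Eᵀ (Z̃ Q̃⁻¹) E` with `Z̃`, `Q̃` block diagonal over the cliques, `Q̃ ≻ 0`,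
and `ρ ∈ ℝ`, `η > 0` such that `-Γ_γ(Q̃, Z̃) + blkdiag(ρ M, 0) ≻ 0` and
`N Q̃ + Q̃ N ⪰ η N`. -/
def Kclique (n : V → ℕ) (C : κ → Finset V) {mv l : ℕ} (p : Plant (StateIdx n) mv l) (γ : ℝ) :
    Set (Matrix (StateIdx n) (StateIdx n) ℝ) :=
  {K | ∃ (Zb Qb : (k : κ) → Matrix (CliqueIdx n (C k)) (CliqueIdx n (C k)) ℝ) (ρ η : ℝ),
    (Matrix.blockDiagonal' Qb).PosDef ∧
    0 < η ∧
    (-(Gam n C p γ (Matrix.blockDiagonal' Qb) (Matrix.blockDiagonal' Zb))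
      + Matrix.fromBlocks (ρ • dilM n C) 0 0 0).PosDef ∧
    (dilN n C * Matrix.blockDiagonal' Qb + Matrix.blockDiagonal' Qb * dilN n C
      - η • dilN n C).PosSemidef ∧
    K = dilL n C * (Matrix.blockDiagonal' Zb * (Matrix.blockDiagonal' Qb)⁻¹) * dilE n C}

end Gains

end CliqueHinf

end

/-! Write `L = (EᵀE)⁻¹Eᵀ`. Since every node is covered, `EᵀE` is an invertible diagonal matrix of
multiplicities, `L E = I`, and `N = I - E L` is the orthogonal projection with kernel `range E`.
Compressing `Γ_γ(Q̃, Z̃)` by `blkdiag(Lᵀ, Lᵀ, I)` gives the undilated matrix at `(L Q̃ Lᵀ, L Z̃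
Lᵀ)`, and the term in `ρ M` disappears.

From clique to all: `N Q̃ + Q̃ N ⪰ η N` forces `Q̃` to preserve `range E`. With `X = L Q̃ Lᵀ ≻ 0`
this gives `L Z̃ Lᵀ = K X`, so the compressed inequality is the bounded real condition for `K`,
which yields stability and the norm bound. An entry of `K` sums contributions of the cliques
containing both its nodes, hence `K ∈ 𝒮`.

From diag to clique: spread the entries of `K = Z Q⁻¹` over the cliques as `K = L W E` with `W`
block diagonal. Let `Q̃` carry copies of `Q_i` scaled by the multiplicity of node `i`, and put `Z̃ =
W Q̃`. Then `L Q̃ Lᵀ = Q` and `L Z̃ Lᵀ = Z`, so `-Γ_γ` is positive definite on the kernel of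
`blkdiag(M, O)`, and Finsler's lemma supplies `ρ`. Since `Q̃` commutes with `N`, some `η` exists. -/

noncomputable section

namespace CliqueHinf

open Matrix

/-! ### Finsler's lemma and uniform positivity -/

/-- Finsler's lemma. -/
theorem exists_posDef_add_smul {ι : Type*} [Fintype ι] {X M : Matrix ι ι ℝ}
    (hX : X.IsHermitian) (hM : M.PosSemidef)
    (h : ∀ x : ι → ℝ, x ≠ 0 → M *ᵥ x = 0 → 0 < x ⬝ᵥ X *ᵥ x) :
    ∃ ρ : ℝ, 0 < ρ ∧ (X + ρ • M).PosDef := by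
  have hcont (A : Matrix ι ι ℝ) : Continuous fun x : ι → ℝ => x ⬝ᵥ A *ᵥ x := by fun_prop
  -- These open sets increase with `k` and cover the unit sphere, so by compactness one of them
  -- suffices. The weight `k + 1` keeps `ρ` positive.
  obtain ⟨k, hk⟩ := (isCompact_sphere (0 : ι → ℝ) 1).elim_directed_cover
    (fun k : ℕ => {x : ι → ℝ | 0 < x ⬝ᵥ X *ᵥ x + ((k : ℝ) + 1) * (x ⬝ᵥ M *ᵥ x)})
    (fun k => isOpen_lt continuous_const ((hcont X).add (continuous_const.mul (hcont M))))
    (by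
      intro x hx
      have hx0 : x ≠ 0 := ne_zero_of_mem_unit_sphere ⟨x, hx⟩
      simp only [Set.mem_iUnion, Set.mem_ofPred_eq]
      have hnn : 0 ≤ x ⬝ᵥ M *ᵥ x := by simpa using hM.dotProduct_mulVec_nonneg x
      rcases hnn.eq_or_lt with h0 | hpos
      · refine ⟨0, ?_⟩
        have : M *ᵥ x = 0 := (hM.dotProduct_mulVec_zero_iff x).1 (by simpa using h0.symm)
        rw [← h0, mul_zero, add_zero]
        exact h x hx0 this
      · obtain ⟨k, hk⟩ := exists_nat_gt (-(x ⬝ᵥ X *ᵥ x) / (x ⬝ᵥ M *ᵥ x))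
        refine ⟨k, ?_⟩
        rw [div_lt_iff₀ hpos] at hk
        linarith)
    (by
      refine directed_of_isDirected_le fun a b hab x hx => ?_
      have hnn : 0 ≤ x ⬝ᵥ M *ᵥ x := by simpa using hM.dotProduct_mulVec_nonneg x
      have hab' : (a : ℝ) ≤ b := by exact_mod_cast hab
      simp only [Set.mem_ofPred_eq] at hx ⊢
      nlinarith [mul_le_mul_of_nonneg_right hab' hnn])
  refine ⟨(k : ℝ) + 1, by positivity, .of_dotProduct_mulVec_pos ?_ fun x hx => ?_⟩
  · exact hX.add (by rw [IsHermitian, conjTranspose_smul, hM.isHermitian.eq, star_trivial])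
  · have hn : 0 < ‖x‖ := norm_pos_iff.2 hx
    have hmem : ‖x‖⁻¹ • x ∈ Metric.sphere (0 : ι → ℝ) 1 := by
      simp [norm_smul, hn.ne']
    have := hk hmem
    simp only [Set.mem_ofPred_eq, mulVec_smul, dotProduct_smul, smul_dotProduct, smul_eq_mul]
      at this
    have h2 : 0 < ‖x‖⁻¹ * (‖x‖⁻¹ * (x ⬝ᵥ X *ᵥ x + ((k : ℝ) + 1) * (x ⬝ᵥ M *ᵥ x))) := by
      linarith
    have h3 := (mul_pos_iff_of_pos_left (inv_pos.2 hn)).1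
      ((mul_pos_iff_of_pos_left (inv_pos.2 hn)).1 h2)
    simpa [add_mulVec, smul_mulVec, dotProduct_add, dotProduct_smul] using h3

/-- Finsler's lemma with `-I` in place of `X`: the kernel of a definite matrix is trivial, so `-I +
ρ X ≻ 0`, and `ε = ρ⁻¹`. -/
theorem _root_.Matrix.PosDef.exists_posSemidef_sub_smul_one {ι : Type*} [Fintype ι]
    [DecidableEq ι] {X : Matrix ι ι ℝ} (hX : X.PosDef) :
    ∃ ε : ℝ, 0 < ε ∧ (X - ε • 1).PosSemidef := by
  obtain ⟨ρ, hρ, h⟩ := exists_posDef_add_smul (X := -1) (M := X) (by simp [IsHermitian])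
    hX.posSemidef (fun x hx h0 => by
      have := hX.dotProduct_mulVec_pos hx
      simp [h0] at this)
  refine ⟨ρ⁻¹, inv_pos.2 hρ, ?_⟩
  have := h.posSemidef.smul (inv_nonneg.2 hρ.le)
  convert this using 1
  rw [smul_add, smul_smul, inv_mul_cancel₀ hρ.ne', one_smul, smul_neg]
  abel

/-! ### Real matrices acting on complex vectors -/

section Complexify

variable {α β δ : Type*}

theorem toC_mul [Fintype β] (M : Matrix α β ℝ) (N : Matrix β δ ℝ) :
    toC (M * N) = toC M * toC N := Matrix.map_mul (f := Complex.ofRealHom)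

theorem toC_one [DecidableEq α] : toC (1 : Matrix α α ℝ) = 1 := by simp [toC]

theorem toC_neg (M : Matrix α β ℝ) : toC (-M) = -toC M := by ext; simp [toC]

theorem toC_zero : toC (0 : Matrix α β ℝ) = 0 := by ext; simp [toC]

theorem toC_smul_one [DecidableEq α] (r : ℝ) :
    toC (r • (1 : Matrix α α ℝ)) = (r : ℂ) • 1 := by
  ext i j; by_cases h : i = j <;> simp [toC, h]

theorem toC_fromBlocks {α' β' : Type*} (A : Matrix α β ℝ) (B : Matrix α β' ℝ)
    (C : Matrix α' β ℝ) (D : Matrix α' β' ℝ) :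
    toC (fromBlocks A B C D) = fromBlocks (toC A) (toC B) (toC C) (toC D) :=
  fromBlocks_map ..

variable [Fintype α] [Fintype β]

theorem re_star_dotProduct_toC_transpose (M : Matrix α β ℝ) (x : α → ℂ) (y : β → ℂ) :
    (star y ⬝ᵥ toC Mᵀ *ᵥ x).re = (star x ⬝ᵥ toC M *ᵥ y).re := by
  simp only [dotProduct, mulVec, Complex.re_sum, Finset.mul_sum]
  rw [Finset.sum_comm]
  refine Finset.sum_congr rfl fun i _ => Finset.sum_congr rfl fun j _ => ?_
  simp [toC]
  ring

/-- The cross terms between real and imaginary parts are purely imaginary because `M` is real; no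
symmetry is needed. -/
theorem re_star_dotProduct_toC_mulVec (M : Matrix α α ℝ) (x : α → ℂ) :
    (star x ⬝ᵥ toC M *ᵥ x).re =
      (fun i => (x i).re) ⬝ᵥ M *ᵥ (fun i => (x i).re) +
        (fun i => (x i).im) ⬝ᵥ M *ᵥ (fun i => (x i).im) := by
  simp only [dotProduct, mulVec, Complex.re_sum, Finset.mul_sum, ← Finset.sum_add_distrib]
  refine Finset.sum_congr rfl fun i _ => Finset.sum_congr rfl fun j _ => ?_
  simp [toC]

theorem re_star_dotProduct_toC_nonneg {M : Matrix α α ℝ} (hM : M.PosSemidef) (x : α → ℂ) :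
    0 ≤ (star x ⬝ᵥ toC M *ᵥ x).re := by
  rw [re_star_dotProduct_toC_mulVec]
  exact add_nonneg (by simpa using hM.dotProduct_mulVec_nonneg fun i => (x i).re)
    (by simpa using hM.dotProduct_mulVec_nonneg fun i => (x i).im)

open scoped ComplexOrder in
theorem re_star_dotProduct_toC_pos {M : Matrix α α ℝ} (hM : M.PosDef) {x : α → ℂ}
    (hx : x ≠ 0) : 0 < (star x ⬝ᵥ toC M *ᵥ x).re := by
  classical
  obtain ⟨ε, hε, h⟩ := hM.exists_posSemidef_sub_smul_one
  have h0 := re_star_dotProduct_toC_nonneg h x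
  have h1 : toC (M - ε • (1 : Matrix α α ℝ)) = toC M - (ε : ℂ) • 1 := by
    rw [← toC_smul_one]; ext; simp [toC]
  rw [h1, sub_mulVec, smul_mulVec, one_mulVec, dotProduct_sub, dotProduct_smul, Complex.sub_re,
    smul_eq_mul, Complex.re_ofReal_mul] at h0
  have h2 : 0 < (star x ⬝ᵥ x).re := (Complex.lt_def.1 (dotProduct_star_self_pos_iff.2 hx)).1
  nlinarith

open scoped ComplexOrder in
theorem re_star_dotProduct_self_nonneg (x : α → ℂ) : 0 ≤ (star x ⬝ᵥ x).re :=
  (Complex.le_def.1 (dotProduct_star_self_nonneg x)).1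

end Complexify

/-! ### The bounded real lemma -/

section BoundedReal

variable {σ : Type*} [Fintype σ] {mv l : ℕ}

theorem star_sumElim {α β : Type*} (x : α → ℂ) (y : β → ℂ) :
    star (Sum.elim x y) = Sum.elim (star x) (star y) := by
  ext (i | i) <;> rfl

/-- Each off-diagonal block and its transpose have the same real part, hence the factors 2. -/
theorem re_form_brl (γ : ℝ) (p : Plant σ mv l) (Q Z : Matrix σ σ ℝ)
    (w₁ w₂ : σ → ℂ) (w₃ : Fin mv → ℂ) (w₄ : Fin l → ℂ) :
    (star (Sum.elim (Sum.elim w₁ w₂) (Sum.elim w₃ w₄)) ⬝ᵥ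
      toC (-brl γ p Q Z) *ᵥ Sum.elim (Sum.elim w₁ w₂) (Sum.elim w₃ w₄)).re =
    (star w₁ ⬝ᵥ toC Q *ᵥ w₁).re + (star w₂ ⬝ᵥ toC Q *ᵥ w₂).re
      - 2 * (star w₁ ⬝ᵥ (toC (p.A * Q + p.B * Z) *ᵥ w₂ + toC p.Bv *ᵥ w₃)).re
      - 2 * (star w₄ ⬝ᵥ (toC (p.C * Q + p.D * Z) *ᵥ w₂ + toC p.Dw *ᵥ w₃)).re
      + γ * (star w₃ ⬝ᵥ w₃).re + γ * (star w₄ ⬝ᵥ w₄).re := by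
  have e₁ := re_star_dotProduct_toC_transpose (p.A * Q + p.B * Z) w₁ w₂
  have e₂ := re_star_dotProduct_toC_transpose p.Bv w₁ w₃
  have e₃ := re_star_dotProduct_toC_transpose (p.C * Q + p.D * Z) w₄ w₂
  have e₄ := re_star_dotProduct_toC_transpose p.Dw w₄ w₃
  rw [toC_neg, neg_mulVec, dotProduct_neg]
  simp only [brl, toC_fromBlocks, toC_neg, toC_smul_one, toC_zero, fromBlocks_mulVec,
    Sum.elim_comp_inl, Sum.elim_comp_inr, star_sumElim, sumElim_dotProduct_sumElim,
    dotProduct_add, neg_mulVec, dotProduct_neg, smul_mulVec, one_mulVec,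
    dotProduct_smul, zero_mulVec, dotProduct_zero, Complex.add_re, Complex.neg_re, smul_eq_mul,
    Complex.re_ofReal_mul, e₁, e₂, e₃, e₄, Complex.zero_re]
  ring

variable [DecidableEq σ] {γ : ℝ} {p : Plant σ mv l} {X K : Matrix σ σ ℝ}

/-- Test the inequality on `(v*, c v*, 0, 0)` for a left eigenvector `v`, where `c` is a phase. With
`q = v X v* > 0` it reads `2 q - 2 |z| q > 0`. -/
theorem isSchur_of_brl (hX : X.PosDef) (h : (-brl γ p X (K * X)).PosDef) :
    IsSchur (p.A + p.B * K) := by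
  intro z hz
  rw [spectrum.mem_iff, isUnit_iff_isUnit_det, isUnit_iff_ne_zero, not_not,
    ← exists_vecMul_eq_zero_iff] at hz
  obtain ⟨v, hv, hvz⟩ := hz
  set Ac := p.A + p.B * K with hAc
  have hvA : v ᵥ* toC Ac = z • v := by
    rw [vecMul_sub, sub_eq_zero, Algebra.algebraMap_eq_smul_one, vecMul_smul, vecMul_one] at hvz
    exact hvz.symm
  by_contra! hge
  have hz0 : ‖z‖ ≠ 0 := by linarith
  have hw : star v ≠ 0 := by simpa using hv
  -- The phase is chosen so that `z c = |z|`, which makes the cross term as large as possible.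
  set c : ℂ := star z / ‖z‖ with hc
  have hz0' : (‖z‖ : ℂ) ≠ 0 := by exact_mod_cast hz0
  have hzz : z * star z = (‖z‖ : ℂ) ^ 2 := by
    rw [Complex.star_def, Complex.mul_conj, Complex.normSq_eq_norm_sq, Complex.ofReal_pow]
  have hcz : z * c = ‖z‖ := by
    rw [hc, mul_div_assoc', hzz, sq, mul_div_cancel_right₀ _ hz0']
  have hcc : star c * c = 1 := by
    have hstar : star (‖z‖ : ℂ) = ‖z‖ := Complex.conj_ofReal _
    rw [hc, star_div₀, star_star, hstar, div_mul_div_comm, hzz, ← sq,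
      div_self (pow_ne_zero 2 hz0')]
  have hne : Sum.elim (Sum.elim (star v) (c • star v)) (Sum.elim (0 : Fin mv → ℂ) (0 : Fin l → ℂ))
      ≠ 0 := fun h0 => hw (funext fun i => congrFun h0 (Sum.inl (Sum.inl i)))
  have hpos := re_star_dotProduct_toC_pos h hne
  have hq := re_star_dotProduct_toC_pos hX hw
  have hR : p.A * X + p.B * (K * X) = Ac * X := by rw [hAc, add_mul, mul_assoc]
  rw [re_form_brl, hR, toC_mul] at hpos
  have e₁ : star (c • star v) ⬝ᵥ toC X *ᵥ (c • star v) = star (star v) ⬝ᵥ toC X *ᵥ star v := by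
    rw [star_smul, mulVec_smul, smul_dotProduct, dotProduct_smul, smul_smul, hcc, one_smul]
  have e₂ : star (star v) ⬝ᵥ ((toC Ac * toC X) *ᵥ (c • star v)) =
      (‖z‖ : ℂ) * (star (star v) ⬝ᵥ toC X *ᵥ star v) := by
    rw [← hcz, ← mulVec_mulVec, mulVec_smul, star_star, mulVec_smul, dotProduct_smul,
      dotProduct_mulVec v (toC Ac), hvA, smul_dotProduct, smul_smul, smul_eq_mul, mul_comm c]
  simp only [mulVec_zero, add_zero, star_zero, zero_dotProduct, Complex.zero_re, mul_zero,
    sub_zero, e₁, e₂, Complex.re_ofReal_mul] at hpos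
  nlinarith

/-- The margin `ε` of the matrix inequality does not depend on `z`; this uniformity keeps the
supremum over the circle strictly below `γ`. -/
theorem exists_uniform_gain_of_brl (hγ : 0 < γ) (hX : X.PosDef)
    (h : (-brl γ p X (K * X)).PosDef) :
    ∃ ε : ℝ, 0 < ε ∧ ∀ z : ℂ, ‖z‖ = 1 → ∀ v : Fin mv → ℂ,
      (star (transfer p K z *ᵥ v) ⬝ᵥ (transfer p K z *ᵥ v)).re ≤
        γ * (γ - ε) * (star v ⬝ᵥ v).re := by
  obtain ⟨ε, hε, hP⟩ := h.exists_posSemidef_sub_smul_one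
  refine ⟨ε, hε, fun z hz v => ?_⟩
  have hS := isSchur_of_brl hX h
  set Ac := p.A + p.B * K with hAc
  set Cc := p.C + p.D * K with hCc
  have hU : IsUnit (z • (1 : Matrix σ σ ℂ) - toC Ac) := by
    by_contra hn
    have := hS z (by rwa [spectrum.mem_iff, Algebra.algebraMap_eq_smul_one])
    linarith
  rw [isUnit_iff_isUnit_det] at hU
  set ξ := (z • (1 : Matrix σ σ ℂ) - toC Ac)⁻¹ *ᵥ (toC p.Bv *ᵥ v) with hξ
  set η := transfer p K z *ᵥ v with hη
  have hη' : toC Cc *ᵥ ξ + toC p.Dw *ᵥ v = η := by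
    rw [hη, transfer, add_mulVec, hξ, mulVec_mulVec, mulVec_mulVec]
  have hξ' : toC Ac *ᵥ ξ + toC p.Bv *ᵥ v = z • ξ := by
    have : (z • (1 : Matrix σ σ ℂ) - toC Ac) *ᵥ ξ = toC p.Bv *ᵥ v := by
      rw [hξ, mulVec_mulVec, mul_nonsing_inv _ hU, one_mulVec]
    rw [sub_mulVec, smul_mulVec, one_mulVec] at this
    rw [← this]; abel
  have hXu : IsUnit X.det := by rw [← isUnit_iff_isUnit_det]; exact hX.isUnit
  have hXX : toC X * toC X⁻¹ = 1 := by rw [← toC_mul, mul_nonsing_inv _ hXu, toC_one]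
  set w₂ := toC X⁻¹ *ᵥ ξ with hw₂
  have hXw : toC X *ᵥ w₂ = ξ := by rw [hw₂, mulVec_mulVec, hXX, one_mulVec]
  have hR : p.A * X + p.B * (K * X) = Ac * X := by rw [hAc, add_mul, mul_assoc]
  have hY : p.C * X + p.D * (K * X) = Cc * X := by rw [hCc, Matrix.add_mul, Matrix.mul_assoc]
  -- With `ξ` the state response and `w₂ = X⁻¹ ξ`, the terms in `X` cancel because `|z| = 1`. The
  -- choice `γ⁻¹ η` for the last block then leaves `γ |v|² - γ⁻¹ |η|²`.
  set w := Sum.elim (Sum.elim (z • w₂) w₂) (Sum.elim v ((γ⁻¹ : ℂ) • η)) with hw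
  have key := re_star_dotProduct_toC_nonneg hP w
  have h1 : toC (-brl γ p X (K * X) - ε • 1) = toC (-brl γ p X (K * X)) - (ε : ℂ) • 1 := by
    rw [← toC_smul_one]; ext; simp [toC]
  rw [h1, sub_mulVec, smul_mulVec, one_mulVec, dotProduct_sub, dotProduct_smul, Complex.sub_re,
    smul_eq_mul, Complex.re_ofReal_mul] at key
  have hww : (star v ⬝ᵥ v).re ≤ (star w ⬝ᵥ w).re := by
    rw [hw, star_sumElim, star_sumElim, star_sumElim, sumElim_dotProduct_sumElim,
      sumElim_dotProduct_sumElim, sumElim_dotProduct_sumElim, Complex.add_re, Complex.add_re,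
      Complex.add_re]
    have a₁ := re_star_dotProduct_self_nonneg (z • w₂)
    have a₂ := re_star_dotProduct_self_nonneg w₂
    have a₃ := re_star_dotProduct_self_nonneg ((γ⁻¹ : ℂ) • η)
    linarith
  have hzz : star z * z = 1 := by
    rw [Complex.star_def, mul_comm, Complex.mul_conj, Complex.normSq_eq_norm_sq, hz]; simp
  have e₁ : star (z • w₂) ⬝ᵥ toC X *ᵥ (z • w₂) = star w₂ ⬝ᵥ ξ := by
    rw [star_smul, mulVec_smul, smul_dotProduct, dotProduct_smul, smul_smul, hzz, one_smul, hXw]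
  have e₂ : star (z • w₂) ⬝ᵥ (z • ξ) = star w₂ ⬝ᵥ ξ := by
    rw [star_smul, smul_dotProduct, dotProduct_smul, smul_smul, hzz, one_smul]
  have hgi : (γ⁻¹ : ℂ) = ((γ⁻¹ : ℝ) : ℂ) := by push_cast; rfl
  have e₃ : (star ((γ⁻¹ : ℂ) • η) ⬝ᵥ η).re = γ⁻¹ * (star η ⬝ᵥ η).re := by
    rw [star_smul, smul_dotProduct, smul_eq_mul, hgi, Complex.star_def, Complex.conj_ofReal,
      Complex.re_ofReal_mul]
  have e₄ : (star ((γ⁻¹ : ℂ) • η) ⬝ᵥ ((γ⁻¹ : ℂ) • η)).re = γ⁻¹ * (γ⁻¹ * (star η ⬝ᵥ η).re) := by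
    rw [dotProduct_smul, smul_eq_mul, hgi, Complex.re_ofReal_mul, ← hgi, e₃]
  rw [re_form_brl, hR, hY, toC_mul, toC_mul, ← mulVec_mulVec, ← mulVec_mulVec, hXw, hξ', hη', e₁,
    e₂, e₃, e₄] at key
  have hgg : γ * (γ⁻¹ * (γ⁻¹ * (star η ⬝ᵥ η).re)) = γ⁻¹ * (star η ⬝ᵥ η).re := by
    field_simp
  have h2 : γ⁻¹ * (star η ⬝ᵥ η).re ≤ (γ - ε) * (star v ⬝ᵥ v).re := by
    nlinarith [mul_le_mul_of_nonneg_left hww hε.le]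
  rw [inv_mul_le_iff₀ hγ] at h2
  linarith

open scoped Matrix.Norms.L2Operator in
theorem hinfNorm_lt_of_brl (hγ : 0 < γ) (hX : X.PosDef) (h : (-brl γ p X (K * X)).PosDef) :
    hinfNorm (transfer p K) < ENNReal.ofReal γ := by
  obtain ⟨ε, hε, hb⟩ := exists_uniform_gain_of_brl hγ hX h
  -- If `γ < ε`, the root takes its default value 0, and the bound still holds.
  have hlt : Real.sqrt (γ * (γ - ε)) < γ := by
    rw [Real.sqrt_lt' hγ]; nlinarith
  refine lt_of_le_of_lt (iSup₂_le fun z hz => ENNReal.ofReal_le_ofReal ?_)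
    ((ENNReal.ofReal_lt_ofReal_iff hγ).2 hlt)
  rw [l2_opNorm_def]
  refine ContinuousLinearMap.opNorm_le_bound _ (Real.sqrt_nonneg _) fun v => ?_
  have hn {m : ℕ} (x : EuclideanSpace ℂ (Fin m)) :
      ‖x‖ ^ 2 = (star x.ofLp ⬝ᵥ x.ofLp).re := by
    rw [EuclideanSpace.norm_sq_eq, dotProduct, Complex.re_sum]
    refine Finset.sum_congr rfl fun i _ => ?_
    rw [Pi.star_apply, Complex.star_def, mul_comm, Complex.mul_conj, Complex.ofReal_re,
      Complex.normSq_eq_norm_sq]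
  rw [← Real.sqrt_sq (norm_nonneg v), ← Real.sqrt_mul' _ (sq_nonneg _)]
  refine Real.le_sqrt_of_sq_le ?_
  rw [hn, hn]
  exact hb z hz v.ofLp

end BoundedReal

/-! ### Block diagonal matrices -/

section Blocks

variable {o : Type*} [Fintype o] [DecidableEq o] {m : o → Type*} [∀ i, Fintype (m i)]

theorem posDef_blockDiagonal'_iff {Q : ∀ i, Matrix (m i) (m i) ℝ} :
    (blockDiagonal' Q).PosDef ↔ ∀ i, (Q i).PosDef := by
  refine ⟨fun h i => ?_, fun h => .of_dotProduct_mulVec_pos ?_ fun x hx => ?_⟩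
  · have := h.submatrix (e := fun a : m i => (⟨i, a⟩ : Σ i, m i)) sigma_mk_injective
    convert this using 1
    ext a b
    simp [blockDiagonal'_apply_eq]
  · exact isHermitian_blockDiagonal'_iff.2 fun i => (h i).isHermitian
  · have key : star x ⬝ᵥ blockDiagonal' Q *ᵥ x =
        ∑ i, (fun a => x ⟨i, a⟩) ⬝ᵥ Q i *ᵥ (fun a => x ⟨i, a⟩) := by
      simp only [dotProduct, mulVec, Fintype.sum_sigma, star_trivial]
      refine Finset.sum_congr rfl fun i _ => Finset.sum_congr rfl fun a _ => ?_
      congr 1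
      rw [Finset.sum_eq_single i]
      · simp [blockDiagonal'_apply_eq]
      · intro j _ hj
        exact Finset.sum_eq_zero fun b _ => by
          rw [blockDiagonal'_apply_ne _ _ _ hj.symm, zero_mul]
      · simp
    rw [key]
    obtain ⟨⟨i, a⟩, ha⟩ := Function.ne_iff.1 hx
    refine Finset.sum_pos' (fun j _ => ?_) ⟨i, Finset.mem_univ _, ?_⟩
    · simpa using (h j).posSemidef.dotProduct_mulVec_nonneg fun a => x ⟨j, a⟩
    · simpa using (h i).dotProduct_mulVec_pos (x := fun a => x ⟨i, a⟩)
        fun h0 => ha (congrFun h0 a)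

theorem inv_blockDiagonal'_of_posDef [∀ i, DecidableEq (m i)] {Q : ∀ i, Matrix (m i) (m i) ℝ}
    (h : ∀ i, (Q i).PosDef) :
    (blockDiagonal' Q)⁻¹ = blockDiagonal' fun i => (Q i)⁻¹ := by
  refine inv_eq_right_inv ?_
  rw [← blockDiagonal'_mul, ← blockDiagonal'_one]
  congr 1
  funext i
  exact mul_nonsing_inv _ ((isUnit_iff_isUnit_det _).1 (h i).isUnit)

end Blocks

/-! ### The dilation `E`, its left inverse and the projection `N` -/

section Dilation

variable {V : Type*} [DecidableEq V] {κ : Type*} {n : V → ℕ} {C : κ → Finset V}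

theorem dilE_apply (p : DilIdx n C) (s : StateIdx n) :
    dilE n C p s = if (⟨p.2.1.1, p.2.2⟩ : StateIdx n) = s then 1 else 0 := rfl

variable [Fintype κ]

/-- The number of members of the family `C` that contain the node `i`. -/
def mult (C : κ → Finset V) (i : V) : ℝ := ((Finset.univ.filter (i ∈ C ·)).card : ℝ)

/-- Column `s` of `E` has exactly one entry 1 in each clique containing the node of `s`, and no
other nonzero entry. -/
theorem sum_dilE_mul (f : DilIdx n C → ℝ) (s : StateIdx n) :
    ∑ p, dilE n C p s * f p =
      ∑ k, if h : s.1 ∈ C k then f ⟨k, ⟨⟨s.1, h⟩, s.2⟩⟩ else 0 := by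
  rw [Fintype.sum_sigma]
  refine Finset.sum_congr rfl fun k _ => ?_
  split_ifs with h
  · rw [Finset.sum_eq_single ⟨⟨s.1, h⟩, s.2⟩]
    · simp [dilE_apply]
    · rintro ⟨⟨j, hj⟩, a⟩ _ hne
      rw [dilE_apply, if_neg, zero_mul]
      rintro rfl
      exact hne rfl
    · simp
  · refine Finset.sum_eq_zero ?_
    rintro ⟨⟨j, hj⟩, a⟩ _
    rw [dilE_apply, if_neg, zero_mul]
    rintro rfl
    exact h hj

theorem dilE_transpose_mul_blockDiagonal'_mul_dilE_apply [DecidableEq κ]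
    (W : ∀ k, Matrix (CliqueIdx n (C k)) (CliqueIdx n (C k)) ℝ) (s t : StateIdx n) :
    ((dilE n C)ᵀ * blockDiagonal' W * dilE n C) s t =
      ∑ k, if h : s.1 ∈ C k ∧ t.1 ∈ C k then
        W k ⟨⟨s.1, h.1⟩, s.2⟩ ⟨⟨t.1, h.2⟩, t.2⟩ else 0 := by
  rw [Matrix.mul_assoc, mul_apply]
  simp only [transpose_apply]
  rw [sum_dilE_mul]
  refine Finset.sum_congr rfl fun k _ => ?_
  by_cases hs : s.1 ∈ C k
  · rw [dif_pos hs, mul_apply]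
    simp only [mul_comm (blockDiagonal' W _ _)]
    rw [sum_dilE_mul, Finset.sum_eq_single k]
    · by_cases ht : t.1 ∈ C k
      · rw [dif_pos ht, dif_pos ⟨hs, ht⟩, blockDiagonal'_apply_eq]
      · rw [dif_neg ht, dif_neg fun h => ht h.2]
    · intro j _ hj
      split_ifs
      · exact blockDiagonal'_apply_ne _ _ _ hj.symm
      · rfl
    · simp
  · rw [dif_neg hs, dif_neg fun h => hs h.1]

theorem dilE_transpose_mul_dilE :
    (dilE n C)ᵀ * dilE n C = diagonal fun s => mult C s.1 := by
  ext s t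
  rw [mul_apply]
  simp only [transpose_apply]
  rw [sum_dilE_mul]
  simp only [dilE_apply]
  by_cases h : s = t
  · subst h
    simp [mult]
  · simp [h]

theorem mult_pos {G : SimpleGraph V} (hC : IsCliqueCover G C) (i : V) : 0 < mult C i := by
  obtain ⟨k, hk⟩ := hC.cover i
  exact Nat.cast_pos.2 (Finset.card_pos.2 ⟨k, by simpa using hk⟩)

/-- `(EᵀE)⁻¹`, a diagonal matrix. -/
def invMult (n : V → ℕ) (C : κ → Finset V) : Matrix (StateIdx n) (StateIdx n) ℝ :=
  diagonal fun s => (mult C s.1)⁻¹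

variable [Fintype V]

theorem dilL_eq {G : SimpleGraph V} (hC : IsCliqueCover G C) :
    dilL n C = invMult n C * (dilE n C)ᵀ := by
  rw [dilL, dilE_transpose_mul_dilE]
  congr 1
  refine inv_eq_right_inv ?_
  rw [invMult, diagonal_mul_diagonal, ← diagonal_one]
  congr 1
  funext s
  exact mul_inv_cancel₀ (mult_pos hC s.1).ne'

theorem dilL_mul_dilE {G : SimpleGraph V} (hC : IsCliqueCover G C) :
    dilL n C * dilE n C = 1 := by
  rw [dilL_eq hC, Matrix.mul_assoc, dilE_transpose_mul_dilE, invMult, diagonal_mul_diagonal,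
    ← diagonal_one]
  congr 1
  funext s
  exact inv_mul_cancel₀ (mult_pos hC s.1).ne'

theorem dilL_transpose {G : SimpleGraph V} (hC : IsCliqueCover G C) :
    (dilL n C)ᵀ = dilE n C * invMult n C := by
  rw [dilL_eq hC, transpose_mul, invMult, diagonal_transpose, transpose_transpose]

theorem dilE_transpose_mul_dilL_transpose {G : SimpleGraph V} (hC : IsCliqueCover G C) :
    (dilE n C)ᵀ * (dilL n C)ᵀ = 1 := by
  rw [← transpose_mul, dilL_mul_dilE hC, transpose_one]

theorem transpose_dilE_mul_dilL {G : SimpleGraph V} (hC : IsCliqueCover G C) :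
    (dilE n C * dilL n C)ᵀ = dilE n C * dilL n C := by
  rw [transpose_mul, dilL_transpose hC, dilL_eq hC, Matrix.mul_assoc]

/-- `blkdiag(((EᵀE)⁻¹Eᵀ)ᵀ, ((EᵀE)⁻¹Eᵀ)ᵀ, I)`. -/
def dilT (n : V → ℕ) (C : κ → Finset V) (mv l : ℕ) :
    Matrix ((DilIdx n C ⊕ DilIdx n C) ⊕ (Fin mv ⊕ Fin l))
      ((StateIdx n ⊕ StateIdx n) ⊕ (Fin mv ⊕ Fin l)) ℝ :=
  fromBlocks (fromBlocks (dilL n C)ᵀ 0 0 (dilL n C)ᵀ) 0 0 1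

/-- `blkdiag(Eᵀ, Eᵀ, I)`. -/
def dilS (n : V → ℕ) (C : κ → Finset V) (mv l : ℕ) :
    Matrix ((StateIdx n ⊕ StateIdx n) ⊕ (Fin mv ⊕ Fin l))
      ((DilIdx n C ⊕ DilIdx n C) ⊕ (Fin mv ⊕ Fin l)) ℝ :=
  fromBlocks (fromBlocks (dilE n C)ᵀ 0 0 (dilE n C)ᵀ) 0 0 1

variable {mv l : ℕ}

theorem dilS_mul_dilT {G : SimpleGraph V} (hC : IsCliqueCover G C) :
    dilS n C mv l * dilT n C mv l = 1 := by
  simp [dilS, dilT, fromBlocks_multiply, dilE_transpose_mul_dilL_transpose hC]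

/-- Compressing `Γ_γ` to the range of `E` gives back the matrix of the original plant. -/
theorem dilT_transpose_mul_Gam_mul_dilT {G : SimpleGraph V} (hC : IsCliqueCover G C)
    (p : Plant (StateIdx n) mv l) (γ : ℝ) (Q Z : Matrix (DilIdx n C) (DilIdx n C) ℝ) :
    (dilT n C mv l)ᵀ * Gam n C p γ Q Z * dilT n C mv l =
      brl γ p (dilL n C * Q * (dilL n C)ᵀ) (dilL n C * Z * (dilL n C)ᵀ) := by
  have h₁ : dilL n C * (dilE n C * p.A * dilL n C * Q + dilE n C * p.B * dilL n C * Z) *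
      (dilL n C)ᵀ = p.A * (dilL n C * Q * (dilL n C)ᵀ) + p.B * (dilL n C * Z * (dilL n C)ᵀ) := by
    simp only [Matrix.mul_add, Matrix.add_mul, Matrix.mul_assoc]
    simp only [← Matrix.mul_assoc (dilL n C) (dilE n C), dilL_mul_dilE hC, Matrix.one_mul]
  have h₂ : (p.C * dilL n C * Q + p.D * dilL n C * Z) * (dilL n C)ᵀ =
      p.C * (dilL n C * Q * (dilL n C)ᵀ) + p.D * (dilL n C * Z * (dilL n C)ᵀ) := by
    simp only [Matrix.add_mul, Matrix.mul_assoc]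
  have h₃ : dilL n C * (dilE n C * p.Bv) = p.Bv := by
    rw [← Matrix.mul_assoc, dilL_mul_dilE hC, Matrix.one_mul]
  rw [brl, ← h₁, ← h₂]
  simp only [Gam, brl, dilPlant, dilT, fromBlocks_transpose, fromBlocks_multiply,
    transpose_transpose, transpose_mul _ (dilL n C)ᵀ, transpose_mul (dilL n C)]
  simp only [transpose_zero, transpose_one, Matrix.zero_mul, Matrix.mul_zero, add_zero, zero_add,
    Matrix.one_mul, Matrix.mul_one, h₃, Matrix.mul_neg, Matrix.mul_assoc]
  congr 1
  · simp [fromBlocks_multiply, Matrix.mul_assoc]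
  · simp [fromBlocks_multiply, Matrix.mul_assoc]
    rw [← transpose_mul, dilL_mul_dilE hC, transpose_one, Matrix.mul_one]

theorem dilL_transpose_mulVec_injective (hC : IsCliqueCover G C) :
    Function.Injective (dilL n C)ᵀ.mulVec := by
  refine Function.LeftInverse.injective (g := (dilE n C)ᵀ.mulVec) fun x => ?_
  rw [mulVec_mulVec, dilE_transpose_mul_dilL_transpose hC, one_mulVec]

theorem dilT_mulVec_injective (hC : IsCliqueCover G C) (mv l : ℕ) :
    Function.Injective (dilT n C mv l).mulVec := by
  refine Function.LeftInverse.injective (g := (dilS n C mv l).mulVec) fun x => ?_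
  rw [mulVec_mulVec, dilS_mul_dilT hC, one_mulVec]

variable [DecidableEq κ]

theorem dilN_transpose {G : SimpleGraph V} (hC : IsCliqueCover G C) :
    (dilN n C)ᵀ = dilN n C := by
  rw [dilN, transpose_sub, transpose_one, transpose_dilE_mul_dilL hC]

theorem dilN_mul_dilE {G : SimpleGraph V} (hC : IsCliqueCover G C) :
    dilN n C * dilE n C = 0 := by
  rw [dilN, Matrix.sub_mul, Matrix.one_mul, Matrix.mul_assoc, dilL_mul_dilE hC, Matrix.mul_one,
    sub_self]

theorem dilN_mul_dilL_transpose {G : SimpleGraph V} (hC : IsCliqueCover G C) :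
    dilN n C * (dilL n C)ᵀ = 0 := by
  rw [dilL_transpose hC, ← Matrix.mul_assoc, dilN_mul_dilE hC, Matrix.zero_mul]

theorem dilN_mul_self {G : SimpleGraph V} (hC : IsCliqueCover G C) :
    dilN n C * dilN n C = dilN n C := by
  nth_rw 2 [dilN]
  rw [Matrix.mul_sub, Matrix.mul_one, ← Matrix.mul_assoc, dilN_mul_dilE hC, Matrix.zero_mul,
    sub_zero]

-- The product is the orthogonal projection onto the kernel of `blkdiag(M, O)`, so vectors of that
-- kernel are recovered from their images under `dilS`.
set_option synthInstance.maxSize 512 in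
theorem dilT_mul_dilS {G : SimpleGraph V} (hC : IsCliqueCover G C) :
    dilT n C mv l * dilS n C mv l = 1 - fromBlocks (dilM n C) 0 0 0 := by
  have : (dilL n C)ᵀ * (dilE n C)ᵀ = 1 - dilN n C := by
    rw [← transpose_mul, transpose_dilE_mul_dilL hC, dilN, sub_sub_cancel]
  rw [eq_sub_iff_add_eq]
  simp [dilS, dilT, dilM, fromBlocks_multiply, fromBlocks_add, this]

theorem fromBlocks_dilM_mul_dilT {G : SimpleGraph V} (hC : IsCliqueCover G C) (ρ : ℝ) :
    fromBlocks (ρ • dilM n C) 0 0 (0 : Matrix (Fin mv ⊕ Fin l) (Fin mv ⊕ Fin l) ℝ) * dilT n C mv l = 0 := by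
  simp [dilM, dilT, fromBlocks_multiply, dilN_mul_dilL_transpose hC, fromBlocks_smul]

/-- A symmetric idempotent equals its own Gram matrix. -/
theorem fromBlocks_dilM_posSemidef {G : SimpleGraph V} (hC : IsCliqueCover G C) :
    (fromBlocks (dilM n C) 0 0 (0 : Matrix (Fin mv ⊕ Fin l) (Fin mv ⊕ Fin l) ℝ)).PosSemidef := by
  have := posSemidef_conjTranspose_mul_self
    (fromBlocks (dilM n C) 0 0 (0 : Matrix (Fin mv ⊕ Fin l) (Fin mv ⊕ Fin l) ℝ))
  simpa [conjTranspose_eq_transpose_of_trivial, dilM, fromBlocks_transpose, fromBlocks_multiply,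
    dilN_transpose hC, dilN_mul_self hC] using this

end Dilation

/-! ### The two inclusions -/

section Gains

variable {V : Type*} [Fintype V] [DecidableEq V] {κ : Type*} [Fintype κ] [DecidableEq κ]
  {G : SimpleGraph V} {C : κ → Finset V} {n : V → ℕ}

theorem dilL_mul_blockDiagonal'_mul_dilE_apply (hC : IsCliqueCover G C)
    (W : ∀ k, Matrix (CliqueIdx n (C k)) (CliqueIdx n (C k)) ℝ) (s t : StateIdx n) :
    (dilL n C * blockDiagonal' W * dilE n C) s t =
      (mult C s.1)⁻¹ * ∑ k, if h : s.1 ∈ C k ∧ t.1 ∈ C k then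
        W k ⟨⟨s.1, h.1⟩, s.2⟩ ⟨⟨t.1, h.2⟩, t.2⟩ else 0 := by
  rw [dilL_eq hC, Matrix.mul_assoc, Matrix.mul_assoc, ← Matrix.mul_assoc _ _ (dilE n C), invMult,
    diagonal_mul, dilE_transpose_mul_blockDiagonal'_mul_dilE_apply]

theorem dilL_mul_blockDiagonal'_mul_dilE_mem_sparse (hC : IsCliqueCover G C)
    (W : ∀ k, Matrix (CliqueIdx n (C k)) (CliqueIdx n (C k)) ℝ) :
    dilL n C * blockDiagonal' W * dilE n C ∈ sparse G n := by
  intro i j hij hadj a b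
  rw [dilL_mul_blockDiagonal'_mul_dilE_apply hC, Finset.sum_eq_zero, mul_zero]
  exact fun k _ => dif_neg fun h => hadj ((hC.common_iff_adj i j hij).1 ⟨k, h⟩)

/-- If `N Q + Q N ⪰ η N`, then `Q` leaves the range of `E` invariant. -/
theorem dilN_mul_mul_dilL_transpose (hC : IsCliqueCover G C)
    {Q : Matrix (DilIdx n C) (DilIdx n C) ℝ} {η : ℝ}
    (h : (dilN n C * Q + Q * dilN n C - η • dilN n C).PosSemidef) :
    dilN n C * Q * (dilL n C)ᵀ = 0 := by
  refine ext_of_mulVec_single fun s => ?_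
  set y := (dilL n C)ᵀ *ᵥ Pi.single s 1 with hy
  have hNy : dilN n C *ᵥ y = 0 := by
    rw [hy, mulVec_mulVec, dilN_mul_dilL_transpose hC, zero_mulVec]
  have hS : (dilN n C * Q + Q * dilN n C - η • dilN n C) *ᵥ y = (dilN n C * Q) *ᵥ y := by
    rw [sub_mulVec, add_mulVec, ← mulVec_mulVec y Q, smul_mulVec, hNy]
    simp
  -- Since `N y = 0`, the semidefinite form vanishes at `y`; hence its matrix annihilates `y`, which
  -- says `N Q y = 0`.
  have hz : star y ⬝ᵥ (dilN n C * Q + Q * dilN n C - η • dilN n C) *ᵥ y = 0 := by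
    rw [hS, ← mulVec_mulVec, dotProduct_mulVec, ← mulVec_transpose, dilN_transpose hC, star_trivial,
      hNy, zero_dotProduct]
  have := (h.dotProduct_mulVec_zero_iff y).1 hz
  rw [hS, hy, mulVec_mulVec] at this
  rw [this, zero_mulVec]

theorem Kclique_subset_Kall (hC : IsCliqueCover G C) {mv l : ℕ}
    (p : Plant (StateIdx n) mv l) {γ : ℝ} (hγ : 0 < γ) :
    Kclique n C p γ ⊆ Kall G n p γ := by
  rintro K ⟨Zb, Qb, ρ, η, hQ, -, hΓ, hN, hK⟩
  have hQb := posDef_blockDiagonal'_iff.1 hQ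
  set Q := blockDiagonal' Qb with hQdef
  set Z := blockDiagonal' Zb with hZdef
  set X := dilL n C * Q * (dilL n C)ᵀ with hXdef
  have hX : X.PosDef := by
    have := hQ.conjTranspose_mul_mul_same (dilL_transpose_mulVec_injective hC)
    rwa [conjTranspose_eq_transpose_of_trivial, transpose_transpose] at this
  -- Invariance of `range E` lets the factor `E L` in `K X` be dropped, after which `Q⁻¹` cancels
  -- `Q`.
  have hKX : dilL n C * Z * (dilL n C)ᵀ = K * X := by
    have hEL : dilE n C * (dilL n C * Q * (dilL n C)ᵀ) = Q * (dilL n C)ᵀ := by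
      have := dilN_mul_mul_dilL_transpose hC hN
      rw [dilN, Matrix.mul_assoc, Matrix.sub_mul, Matrix.one_mul, sub_eq_zero] at this
      rw [this]
      simp only [Matrix.mul_assoc]
    rw [hK, hXdef, Matrix.mul_assoc _ (dilE n C), hEL]
    simp only [Matrix.mul_assoc]
    rw [← Matrix.mul_assoc Q⁻¹, nonsing_inv_mul _ ((isUnit_iff_isUnit_det _).1 hQ.isUnit),
      Matrix.one_mul]
  have hbrl : (-brl γ p X (K * X)).PosDef := by
    have := hΓ.conjTranspose_mul_mul_same (dilT_mulVec_injective hC mv l)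
    rwa [conjTranspose_eq_transpose_of_trivial, Matrix.mul_add, Matrix.add_mul,
      Matrix.mul_assoc _ (fromBlocks _ _ _ _), fromBlocks_dilM_mul_dilT hC, Matrix.mul_zero,
      add_zero, Matrix.mul_neg, Matrix.neg_mul, dilT_transpose_mul_Gam_mul_dilT hC, hKX] at this
  refine ⟨?_, isSchur_of_brl hX hbrl, hinfNorm_lt_of_brl hγ hX hbrl⟩
  rw [hK, hQdef, hZdef, inv_blockDiagonal'_of_posDef hQb, ← blockDiagonal'_mul]
  exact dilL_mul_blockDiagonal'_mul_dilE_mem_sparse hC _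

/-- Every `K ∈ 𝒮` is the compression of a gain that is block diagonal over the cliques. -/
theorem exists_blockDiagonal'_of_mem_sparse (hC : IsCliqueCover G C)
    {K : Matrix (StateIdx n) (StateIdx n) ℝ} (hK : K ∈ sparse G n) :
    ∃ W : ∀ k, Matrix (CliqueIdx n (C k)) (CliqueIdx n (C k)) ℝ,
      dilL n C * blockDiagonal' W * dilE n C = K := by
  -- Each entry of `K` is shared equally among the cliques containing both nodes; the factor `mult`
  -- offsets `(EᵀE)⁻¹`.
  refine ⟨fun k => of fun a b => mult C a.1.1 *
    (((Finset.univ.filter fun k => a.1.1 ∈ C k ∧ b.1.1 ∈ C k).card : ℝ)⁻¹ *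
      K ⟨a.1.1, a.2⟩ ⟨b.1.1, b.2⟩), ?_⟩
  ext s t
  rw [dilL_mul_blockDiagonal'_mul_dilE_apply hC]
  simp only [of_apply, dite_eq_ite, Sigma.eta]
  rw [← Finset.sum_filter, Finset.sum_const, nsmul_eq_mul, mul_left_comm _ (mult C s.1),
    inv_mul_cancel_left₀ (mult_pos hC s.1).ne']
  -- Without a common clique the nodes are distinct and not adjacent, so the entry of `K` is zero.
  rcases Finset.eq_empty_or_nonempty (Finset.univ.filter fun k => s.1 ∈ C k ∧ t.1 ∈ C k)
    with h | h
  · rw [h, Finset.card_empty, Nat.cast_zero, zero_mul]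
    have hno : ¬ ∃ k, s.1 ∈ C k ∧ t.1 ∈ C k := fun ⟨k, hk⟩ =>
      Finset.notMem_empty k (h ▸ by simpa using hk)
    have hst : s.1 ≠ t.1 := fun he => by
      obtain ⟨k, hk⟩ := hC.cover s.1
      exact hno ⟨k, hk, he ▸ hk⟩
    exact (hK s.1 t.1 hst (fun ha => hno ((hC.common_iff_adj _ _ hst).2 ha)) s.2 t.2).symm
  · exact mul_inv_cancel_left₀ (Nat.cast_ne_zero.2 (Finset.card_pos.2 h).ne') _

/-- Copying the blocks of a block diagonal matrix into every clique commutes with `E`. -/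
theorem blockDiagonal'_mul_dilE (X : ∀ i, Matrix (Fin (n i)) (Fin (n i)) ℝ) :
    blockDiagonal' (fun k => blockDiagonal' fun j : {j // j ∈ C k} => X j.1) * dilE n C =
      dilE n C * blockDiagonal' X := by
  ext ⟨k, ⟨j, hj⟩, a⟩ t
  have hr : (dilE n C * blockDiagonal' X) ⟨k, ⟨j, hj⟩, a⟩ t = blockDiagonal' X ⟨j, a⟩ t := by
    rw [mul_apply]
    simp [dilE_apply]
  rw [hr, mul_apply]
  simp only [mul_comm (blockDiagonal' _ _ _) (dilE n C _ _)]
  rw [sum_dilE_mul, Finset.sum_eq_single k]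
  · obtain ⟨i, b⟩ := t
    split_ifs with h
    · rw [blockDiagonal'_apply_eq]
      by_cases hij : j = i
      · subst hij
        rw [blockDiagonal'_apply_eq, blockDiagonal'_apply_eq]
      · rw [blockDiagonal'_apply_ne _ _ _ hij, blockDiagonal'_apply_ne]
        exact fun he => hij (congrArg Subtype.val he)
    · rw [blockDiagonal'_apply_ne]
      rintro rfl
      exact h hj
  · intro k' _ hk'
    split_ifs
    · exact blockDiagonal'_apply_ne _ _ _ hk'.symm
    · rfl
  · simp

/-- A symmetric matrix that preserves `range E` also preserves its orthogonal complement, so it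
commutes with the projection. -/
theorem dilN_mul_comm_of_mul_dilE (hC : IsCliqueCover G C)
    {Q : Matrix (DilIdx n C) (DilIdx n C) ℝ} {X : Matrix (StateIdx n) (StateIdx n) ℝ}
    (hQ : Qᵀ = Q) (h : Q * dilE n C = dilE n C * X) : dilN n C * Q = Q * dilN n C := by
  set P := dilE n C * dilL n C with hP
  have h₁ : P * Q * P = Q * P := by
    rw [Matrix.mul_assoc, hP, ← Matrix.mul_assoc Q, h, Matrix.mul_assoc, Matrix.mul_assoc,
      ← Matrix.mul_assoc (dilL n C), dilL_mul_dilE hC, Matrix.one_mul]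
  have h₂ : P * Q * P = P * Q := by
    have hPt : Pᵀ = P := transpose_dilE_mul_dilL hC
    have := congrArg transpose h₁
    simpa only [transpose_mul, hQ, hPt, Matrix.mul_assoc] using this
  rw [dilN, ← hP, Matrix.sub_mul, Matrix.mul_sub, ← h₂, h₁, Matrix.one_mul, Matrix.mul_one]

/-- If `Q ⪰ ε I` commutes with `N`, then `N Q + Q N = 2 N Q N ⪰ 2 ε N`. -/
theorem exists_posSemidef_dilN (hC : IsCliqueCover G C)
    {Q : Matrix (DilIdx n C) (DilIdx n C) ℝ} (hQ : Q.PosDef)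
    (h : dilN n C * Q = Q * dilN n C) :
    ∃ η : ℝ, 0 < η ∧ (dilN n C * Q + Q * dilN n C - η • dilN n C).PosSemidef := by
  obtain ⟨ε, hε, hQε⟩ := hQ.exists_posSemidef_sub_smul_one
  refine ⟨2 * ε, by positivity, ?_⟩
  have := (hQε.conjTranspose_mul_mul_same (dilN n C)).smul (zero_le_two (α := ℝ))
  convert this using 1
  rw [conjTranspose_eq_transpose_of_trivial, dilN_transpose hC, Matrix.mul_sub, Matrix.sub_mul, h,
    Matrix.mul_assoc Q, dilN_mul_self hC, Matrix.mul_smul, Matrix.smul_mul, Matrix.mul_one,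
    dilN_mul_self hC, smul_sub, smul_smul, two_smul]

theorem brl_isHermitian {σ : Type*} [Fintype σ] {mv l : ℕ} (γ : ℝ)
    (p : Plant σ mv l) {Q : Matrix σ σ ℝ} (hQ : Qᵀ = Q) (Z : Matrix σ σ ℝ) :
    (brl γ p Q Z).IsHermitian := by
  rw [IsHermitian, conjTranspose_eq_transpose_of_trivial]
  simp only [brl, fromBlocks_transpose, transpose_neg, transpose_smul, transpose_one,
    transpose_transpose, transpose_zero, hQ]

set_option synthInstance.maxSize 512 in
theorem Kdiag_subset_Kclique (hC : IsCliqueCover G C) {mv l : ℕ}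
    (p : Plant (StateIdx n) mv l) (γ : ℝ) :
    Kdiag G n p γ ⊆ Kclique n C p γ := by
  rintro K ⟨Z, Qb, hZ, hQ, hbrl, hK⟩
  have hQb := posDef_blockDiagonal'_iff.1 hQ
  set Q := blockDiagonal' Qb with hQdef
  have hQu := (isUnit_iff_isUnit_det _).1 hQ.isUnit
  have hKs : K ∈ sparse G n := by
    intro i j hij hadj a b
    rw [hK, hQdef, inv_blockDiagonal'_of_posDef hQb, mul_apply]
    refine Finset.sum_eq_zero ?_
    rintro ⟨r, c⟩ -
    by_cases hr : r = j
    · subst hr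
      rw [hZ i r hij hadj, zero_mul]
    · rw [blockDiagonal'_apply_ne _ _ _ hr, mul_zero]
  obtain ⟨W, hW⟩ := exists_blockDiagonal'_of_mem_sparse hC hKs
  -- Scaling the block of node `i` by its multiplicity makes the compression below exactly `Q`.
  set Xb : ∀ i, Matrix (Fin (n i)) (Fin (n i)) ℝ := fun i => mult C i • Qb i with hXb
  set Qt : ∀ k, Matrix (CliqueIdx n (C k)) (CliqueIdx n (C k)) ℝ :=
    fun k => blockDiagonal' fun j : {j // j ∈ C k} => Xb j.1 with hQt
  have hQtpd : ∀ k, (Qt k).PosDef := fun k =>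
    posDef_blockDiagonal'_iff.2 fun j => (hQb j.1).smul (mult_pos hC j.1)
  have hQtp : (blockDiagonal' Qt).PosDef := posDef_blockDiagonal'_iff.2 hQtpd
  have hQtu := (isUnit_iff_isUnit_det _).1 hQtp.isUnit
  have hQE : blockDiagonal' Qt * dilE n C = dilE n C * blockDiagonal' Xb :=
    blockDiagonal'_mul_dilE Xb
  have hXQ : blockDiagonal' Xb * invMult n C = Q := by
    ext s t
    rw [invMult, mul_diagonal]
    obtain ⟨i, a⟩ := s
    obtain ⟨j, b⟩ := t
    by_cases hij : i = j
    · subst hij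
      rw [hQdef, blockDiagonal'_apply_eq, blockDiagonal'_apply_eq]
      change mult C i * Qb i a b * (mult C i)⁻¹ = Qb i a b
      rw [mul_comm, inv_mul_cancel_left₀ (mult_pos hC i).ne']
    · rw [hQdef, blockDiagonal'_apply_ne _ _ _ hij, blockDiagonal'_apply_ne _ _ _ hij, zero_mul]
  have hQL : blockDiagonal' Qt * (dilL n C)ᵀ = dilE n C * Q := by
    rw [dilL_transpose hC, ← Matrix.mul_assoc, hQE, Matrix.mul_assoc, hXQ]
  have hsymm : (blockDiagonal' Qt)ᵀ = blockDiagonal' Qt := by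
    rw [← conjTranspose_eq_transpose_of_trivial]; exact hQtp.isHermitian
  have hcQ : dilL n C * blockDiagonal' Qt * (dilL n C)ᵀ = Q := by
    rw [Matrix.mul_assoc, hQL, ← Matrix.mul_assoc, dilL_mul_dilE hC, Matrix.one_mul]
  -- With `Z̃ = W Q̃` the compression is `L W E Q = K Q = Z`.
  have hcZ : dilL n C * blockDiagonal' (fun k => W k * Qt k) * (dilL n C)ᵀ = Z := by
    rw [blockDiagonal'_mul, Matrix.mul_assoc, Matrix.mul_assoc, hQL, ← Matrix.mul_assoc _ _ Q,
      ← Matrix.mul_assoc, ← Matrix.mul_assoc, hW, hK, Matrix.mul_assoc, nonsing_inv_mul _ hQu,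
      Matrix.mul_one]
  obtain ⟨η, hη, hN⟩ := exists_posSemidef_dilN hC hQtp (dilN_mul_comm_of_mul_dilE hC hsymm hQE)
  set Γ := Gam n C p γ (blockDiagonal' Qt) (blockDiagonal' fun k => W k * Qt k) with hΓdef
  have hcΓ : (dilT n C mv l)ᵀ * Γ * dilT n C mv l = brl γ p Q Z := by
    rw [hΓdef, dilT_transpose_mul_Gam_mul_dilT hC, hcQ, hcZ]
  obtain ⟨ρ, -, hρ⟩ := exists_posDef_add_smul (X := -Γ) (brl_isHermitian γ _ hsymm _).neg
    (fromBlocks_dilM_posSemidef (n := n) (mv := mv) (l := l) hC) (by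
      intro w hw hMw
      -- On the kernel of `blkdiag(M, O)`, the form of `-Γ` at `w` is the undilated form at `dilS *ᵥ
      -- w`, which is positive by hypothesis.
      have hwT : dilT n C mv l *ᵥ (dilS n C mv l *ᵥ w) = w := by
        rw [mulVec_mulVec, dilT_mul_dilS hC, sub_mulVec, hMw, one_mulVec, sub_zero]
      have hw' : dilS n C mv l *ᵥ w ≠ 0 := fun h0 => hw (by rw [← hwT, h0, mulVec_zero])
      have hpos := hbrl.dotProduct_mulVec_pos hw'
      rw [← hcΓ, ← Matrix.neg_mul, ← Matrix.mul_neg, star_trivial, ← mulVec_mulVec,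
        ← mulVec_mulVec, hwT, dotProduct_mulVec, vecMul_transpose, hwT] at hpos
      exact hpos)
  refine ⟨fun k => W k * Qt k, Qt, ρ, η, hQtp, hη, ?_, hN, ?_⟩
  · simpa only [fromBlocks_smul, smul_zero] using hρ
  · rw [blockDiagonal'_mul, Matrix.mul_assoc (blockDiagonal' W), mul_nonsing_inv _ hQtu,
      Matrix.mul_one, hW]

end Gains

end CliqueHinf
end

theorem lemma10 {V : Type*} [Fintype V] [DecidableEq V]
    {κ : Type*} [Fintype κ] [DecidableEq κ]
    (G : SimpleGraph V) (C : κ → Finset V) (hC : CliqueHinf.IsCliqueCover G C)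
    (n : V → ℕ) {mv l : ℕ} (p : CliqueHinf.Plant (CliqueHinf.StateIdx n) mv l)
    (γ : ℝ) (hγ : 0 < γ) :
    CliqueHinf.Kdiag G n p γ ⊆ CliqueHinf.Kclique n C p γ ∧
      CliqueHinf.Kclique n C p γ ⊆ CliqueHinf.Kall G n p γ :=
  ⟨CliqueHinf.Kdiag_subset_Kclique hC p γ, CliqueHinf.Kclique_subset_Kall hC p hγ⟩
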